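/- Let $\mathcal X$ be a separable metric space with at least two points, let $\Omega=\mathcal X^{\infty}$ be the set of infinite sequences (paths) in $\mathcal X$ with the product topology, and let $\Sigma$ be a $\sigma$-algebra on $\Omega$ that contains all open sets; its members are called events. For $\omega\in\Omega$ and $t\ge 0$ let $\omega^{t}\subseteq\Omega$ be the cylinder of all paths that coincide with $\omega$ in the first $t$ periods (so $\omega^{0}=\Omega$), and let $\mathcal H$ be the set of all cylinders. A conditional probability is a function $P\colon\Sigma\times\mathcal H\to[0,1]$ such that for all $\omega\in\Omega$ and $t,n\ge 0$: (1) $P(\cdot\mid\omega^{t})$ is a finitely additive probability on $(\Omega,\Sigma)$; (2) $P(\omega^{t}\mid\omega^{t})=1$; (3) $P(E\cap\omega^{t+n}\mid\omega^{t})=P(E\mid\omega^{t+n})\,P(\omega^{t+n}\mid\omega^{t})$ for every event $E$. It is a conditional opinion if $P(\cdot\mid\Omega)$ is strongly nonatomic, i.e. for every event $E$ and every $\alpha\in[0,1]$ there is an event $F\subseteq E$ with $P(F\mid\Omega)=\alpha P(E\mid\Omega)$. Let $\Delta^{*}$ be the set of all conditional opinions. A test is a function $T$ that maps each $P\in\Delta^{*}$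 to an open subset $T(P)$ of $\Omega$. For $\varepsilon\in[0,1)$, the test $T$ $\Delta^{*}$-controls for type I error with probability $1-\varepsilon$ if $P(T(P)\mid\Omega)\le\varepsilon$ for every $P\in\Delta^{*}$. For $q\in[0,1]$, the test $T$ can be manipulated with probability $q$ if there is a probability measure $\zeta$ with finite support on $\Delta^{*}$ such that $\zeta(\{P\in\Delta^{*}:\omega\notin T(P)\})\ge q$ for every $\omega\in\Omega$. Theorem. Let $\varepsilon\in[0,1)$ and let $T$ be a test that $\Delta^{*}$-controls for type I error with probability $1-\varepsilon$. Then $T$ can be manipulated with probability $1-\varepsilon-\delta$, for every $\delta\in(0,1-\varepsilon]$. -/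

import Mathlib

noncomputable section

namespace OpinionTest

open Set TopologicalSpace

/-- The set `Ω = X^∞` of paths; it carries the product topology. -/
abbrev Path (X : Type*) : Type _ := ℕ → X

/-- The events: the members of the `σ`-algebra `Σ` of `Ω`. -/
abbrev Event (Ω : Type*) [MeasurableSpace Ω] : Type _ := {E : Set Ω // MeasurableSet E}

/-- Finitely additive probabilities on `(Ω, Σ)`. -/
@[ext]
structure FinAddProb (Ω : Type*) [MeasurableSpace Ω] where
  /-- the probability of an event -/
  prob : Event Ω → ℝ
  nonneg : ∀ E, 0 ≤ prob E
  prob_univ : prob ⟨univ, MeasurableSet.univ⟩ = 1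
  prob_union : ∀ E F : Event Ω, Disjoint E.1 F.1 →
    prob ⟨E.1 ∪ F.1, E.2.union F.2⟩ = prob E + prob F

/-- Strong nonatomicity: every event `E` and `α ∈ [0,1]` admit an event `F ⊆ E` with
`P F = α P E`. -/
def FinAddProb.StronglyNonatomic {Ω : Type*} [MeasurableSpace Ω] (P : FinAddProb Ω) : Prop :=
  ∀ (E : Event Ω) (α : ℝ), 0 ≤ α → α ≤ 1 →
    ∃ F : Event Ω, F.1 ⊆ E.1 ∧ P.prob F = α * P.prob E

/-- The set `H` of cylinders `ω^t` (all paths that agree with `ω` in the first `t` periods).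
Cylinders are sets: `ω^t` and `η^t` are the same cylinder if `ω` and `η` agree in the first
`t` periods. -/
abbrev Cyl (X : Type*) : Type _ :=
  {C : Set (Path X) // ∃ (ω : Path X) (t : ℕ), PiNat.cylinder ω t = C}

/-- The cylinder `ω^t`. -/
def cyl {X : Type*} (ω : Path X) (t : ℕ) : Cyl X := ⟨PiNat.cylinder ω t, ω, t, rfl⟩

/-- The whole space `Ω = ω^0` as a cylinder. -/
def wholeCyl (X : Type*) [Nonempty X] : Cyl X :=
  ⟨univ, Classical.arbitrary _, 0, PiNat.cylinder_zero _⟩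

section

variable {X : Type*} [MetricSpace X] [MeasurableSpace (Path X)] [OpensMeasurableSpace (Path X)]

/-- Cylinders are closed, hence events as soon as `Σ` contains the open sets. -/
theorem measurableSet_cylinder (ω : Path X) (t : ℕ) : MeasurableSet (PiNat.cylinder ω t) := by
  have h : IsClosed (PiNat.cylinder ω t) := by
    simp only [PiNat.cylinder_eq_pi]
    exact isClosed_set_pi fun i _ => isClosed_singleton
  exact h.measurableSet

/-- The cylinder `ω^t` as an event. -/
def cylEvent (ω : Path X) (t : ℕ) : Event (Path X) :=
  ⟨PiNat.cylinder ω t, measurableSet_cylinder ω t⟩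

/-- An open set as an event. -/
def openEvent (U : Opens (Path X)) : Event (Path X) := ⟨U, U.isOpen.measurableSet⟩

end

section

variable (X : Type*) [MetricSpace X] [MeasurableSpace (Path X)] [OpensMeasurableSpace (Path X)]

/-- Conditional probabilities: `(cond C).prob E` is `P (E | C)`. -/
@[ext]
structure CondProb where
  /-- `P (· | C)`, a finitely additive probability for every cylinder `C` -/
  cond : Cyl X → FinAddProb (Path X)
  cond_self : ∀ (ω : Path X) (t : ℕ), (cond (cyl ω t)).prob (cylEvent ω t) = 1
  cond_chain : ∀ (ω : Path X) (t n : ℕ) (E : Event (Path X)),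
    (cond (cyl ω t)).prob
        ⟨E.1 ∩ PiNat.cylinder ω (t + n), E.2.inter (measurableSet_cylinder ω (t + n))⟩ =
      (cond (cyl ω (t + n))).prob E * (cond (cyl ω t)).prob (cylEvent ω (t + n))

variable [Nonempty X]

/-- Conditional opinions: conditional probabilities `P` such that `P (· | Ω)` is strongly
nonatomic. -/
@[ext]
structure CondOpinion extends CondProb X where
  nonatomic : (cond (wholeCyl X)).StronglyNonatomic

/-- The unconditional part `P (· | Ω)` of a conditional opinion. -/
def CondOpinion.uncond {X : Type*} [MetricSpace X] [MeasurableSpace (Path X)]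
    [OpensMeasurableSpace (Path X)] [Nonempty X] (P : CondOpinion X) : FinAddProb (Path X) :=
  P.cond (wholeCyl X)

/-- A test maps every conditional opinion `P` to an open set `T P` of paths; an expert who
announces `P` is rejected on the paths in `T P`. -/
abbrev Test : Type _ := CondOpinion X → Opens (Path X)

/-- A strategy: a probability measure with finite support on the set of conditional opinions,
given by its point masses. -/
structure Strategy where
  /-- the point masses -/
  weight : CondOpinion X →₀ ℝ
  weight_nonneg : ∀ P, 0 ≤ weight P
  weight_total : ∑ P ∈ weight.support, weight P = 1

end

section

variable {X : Type*} [MetricSpace X] [MeasurableSpace (Path X)] [OpensMeasurableSpace (Path X)]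
  [Nonempty X]

open Classical in
/-- The probability that the strategy `ζ` gives to a set `S` of conditional opinions. -/
def Strategy.prob (ζ : Strategy X) (S : Set (CondOpinion X)) : ℝ :=
  ∑ P ∈ ζ.weight.support with P ∈ S, ζ.weight P

/-- `T` `Λ`-controls for type I error with probability `1 - ε`. -/
def Test.ControlsTypeI (T : Test X) (Λ : Set (CondOpinion X)) (ε : ℝ) : Prop :=
  ∀ P ∈ Λ, P.uncond.prob (openEvent (T P)) ≤ ε

/-- `T` can be manipulated with probability `q`. -/
def Test.CanBeManipulated (T : Test X) (q : ℝ) : Prop :=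
  ∃ ζ : Strategy X, ∀ ω : Path X, q ≤ ζ.prob {P | ω ∉ T P}

end

end OpinionTest

end

/-! If `T` is not manipulable with probability `1 - c`, `c = ε + δ`, then every finite mixture of
opinions is rejected with probability above `c` on some path. A minimax argument turns this into one
opinion `Q` with `Q (T P) ≥ c > ε` for all `P`; taking `P = Q` contradicts the type I bound.
Nature's mixed strategy must be strongly nonatomic, so the point mass at `ω` is replaced by `diffuse
y ω`, a finitely additive probability that gives mass one to every open neighbourhood of `ω`. As `T
P` is open, it dominates the indicator of `T P` at `ω` (`diffuse_eq_one_of_isOpen`). Hahn–Banach in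
`ℓ^∞` (`exists_mean_of_convex`) gives a mean over `ω`, and averaging the diffuse probabilities by it
gives `Q`. A mean is defined on all bounded functions, so measurability in `ω` plays no role. `Q` is
strongly continuous (`mixture_stronglyContinuous`), hence strongly nonatomic, and extends to a
conditional opinion. -/

noncomputable section

namespace OpinionTest

open Set TopologicalSpace Filter Topology
open scoped ENNReal

/-! ### Finitely additive probabilities: strong continuity implies strong nonatomicity. -/

section FinitelyAdditive

variable {Ω : Type*} [MeasurableSpace Ω]

theorem FinAddProb.mono (m : FinAddProb Ω) {E F : Event Ω} (h : E.1 ⊆ F.1) :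
    m.prob E ≤ m.prob F := by
  have h1 := m.prob_union E ⟨F.1 \ E.1, F.2.diff E.2⟩ disjoint_sdiff_right
  have h2 : (⟨E.1 ∪ F.1 \ E.1, E.2.union (F.2.diff E.2)⟩ : Event Ω) = F :=
    Subtype.ext (union_sdiff_cancel h)
  rw [h2] at h1
  linarith [m.nonneg ⟨F.1 \ E.1, F.2.diff E.2⟩]

theorem FinAddProb.union_le (m : FinAddProb Ω) (E F : Event Ω) :
    m.prob ⟨E.1 ∪ F.1, E.2.union F.2⟩ ≤ m.prob E + m.prob F := by
  have h1 := m.prob_union E ⟨F.1 \ E.1, F.2.diff E.2⟩ disjoint_sdiff_right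
  have h2 : (⟨E.1 ∪ F.1 \ E.1, E.2.union (F.2.diff E.2)⟩ : Event Ω) =
      ⟨E.1 ∪ F.1, E.2.union F.2⟩ := Subtype.ext union_sdiff_self
  rw [h2] at h1
  have h3 : m.prob ⟨F.1 \ E.1, F.2.diff E.2⟩ ≤ m.prob F := m.mono sdiff_subset
  linarith

theorem FinAddProb.prob_empty (m : FinAddProb Ω) : m.prob ⟨∅, MeasurableSet.empty⟩ = 0 := by
  have h1 := m.prob_union ⟨∅, MeasurableSet.empty⟩ ⟨∅, MeasurableSet.empty⟩ (disjoint_empty _)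
  have h2 : (⟨∅ ∪ ∅, MeasurableSet.empty.union MeasurableSet.empty⟩ : Event Ω) =
      ⟨∅, MeasurableSet.empty⟩ := Subtype.ext (union_empty _)
  rw [h2] at h1
  linarith

/-- Strong continuity: there are finite covers by events of arbitrarily small probability. -/
def FinAddProb.StronglyContinuous (m : FinAddProb Ω) : Prop :=
  ∀ η : ℝ, 0 < η → ∃ (N : ℕ) (B : ℕ → Event Ω),
    (∀ i, m.prob (B i) ≤ η) ∧ ⋃ i ∈ Finset.range N, (B i).1 = univ

/-- Pieces of a fine cover are adjoined to `E` inside `G` one at a time; each raises the probability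
by at most `η`, so the sets just before and at the crossing of `s` will do. -/
theorem FinAddProb.StronglyContinuous.exists_between {m : FinAddProb Ω}
    (hm : m.StronglyContinuous) {E G : Event Ω} (hEG : E.1 ⊆ G.1) {s : ℝ}
    (hE : m.prob E ≤ s) (hG : s ≤ m.prob G) {η : ℝ} (hη : 0 < η) :
    ∃ E' G' : Event Ω, E.1 ⊆ E'.1 ∧ E'.1 ⊆ G'.1 ∧ G'.1 ⊆ G.1 ∧
      m.prob E' ≤ s ∧ s ≤ m.prob G' ∧ m.prob G' ≤ m.prob E' + η := by
  obtain ⟨N, B, hB, hcov⟩ := hm η hη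
  let H : ℕ → Event Ω := fun k => ⟨E.1 ∪ (G.1 ∩ ⋃ i ∈ Finset.range k, (B i).1),
    E.2.union (G.2.inter (Finset.measurableSet_biUnion _ fun i _ => (B i).2))⟩
  have hH0 : H 0 = E := Subtype.ext (by simp [H])
  have hHN : H N = G := Subtype.ext (by
    simp only [H, hcov, inter_univ, union_eq_self_of_subset_left hEG])
  have hex : ∃ k, s ≤ m.prob (H k) := ⟨N, hHN ▸ hG⟩
  classical
  have hEH : ∀ k, E.1 ⊆ (H k).1 := fun k => subset_union_left
  have hHG : ∀ k, (H k).1 ⊆ G.1 := fun k => union_subset hEG inter_subset_left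
  rcases hk : Nat.find hex with _ | k
  · have h1 := Nat.find_spec hex
    rw [hk, hH0] at h1
    exact ⟨E, E, Subset.rfl, Subset.rfl, hEG, hE, h1, by linarith⟩
  · have h1 := Nat.find_spec hex
    rw [hk] at h1
    have h2 : ¬ s ≤ m.prob (H k) := Nat.find_min hex (by omega)
    have hsub : (H (k + 1)).1 ⊆ (H k).1 ∪ (B k).1 := by
      intro x hx
      simp only [H, mem_union, mem_inter_iff, mem_iUnion, Finset.mem_range, exists_prop] at hx ⊢
      rcases hx with hx | ⟨hxG, i, hi, hxi⟩
      · exact Or.inl (Or.inl hx)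
      · rcases Nat.lt_succ_iff_lt_or_eq.mp hi with hi | rfl
        · exact Or.inl (Or.inr ⟨hxG, i, hi, hxi⟩)
        · exact Or.inr hxi
    refine ⟨H k, H (k + 1), hEH k, ?_, hHG _, le_of_not_ge h2, h1, ?_⟩
    · refine union_subset_union_right _ (inter_subset_inter_right _ ?_)
      exact biUnion_subset_biUnion_left fun i hi => by
        simp only [Finset.coe_range, mem_Iio] at hi ⊢
        omega
    · calc m.prob (H (k + 1)) ≤ m.prob ⟨(H k).1 ∪ (B k).1, (H k).2.union (B k).2⟩ := m.mono hsub
        _ ≤ m.prob (H k) + m.prob (B k) := m.union_le _ _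
        _ ≤ m.prob (H k) + η := by linarith [hB k]

/-- Inner sets increase and outer sets decrease around the level `s` with vanishing gap. Their
probabilities squeeze that of the union of the inner sets, so countable additivity is not needed. -/
theorem FinAddProb.StronglyContinuous.stronglyNonatomic {m : FinAddProb Ω}
    (hm : m.StronglyContinuous) : m.StronglyNonatomic := by
  intro E α hα0 hα1
  set s := α * m.prob E with hs
  have hs0 : 0 ≤ s := mul_nonneg hα0 (m.nonneg E)
  have hsE : s ≤ m.prob E := mul_le_of_le_one_left (m.nonneg E) hα1
  let S := {p : Event Ω × Event Ω // p.1.1 ⊆ p.2.1 ∧ m.prob p.1 ≤ s ∧ s ≤ m.prob p.2}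
  have step : ∀ (n : ℕ) (p : S), ∃ q : S, p.1.1.1 ⊆ q.1.1.1 ∧ q.1.2.1 ⊆ p.1.2.1 ∧
      m.prob q.1.2 ≤ m.prob q.1.1 + 1 / ((n : ℝ) + 1) := by
    rintro n ⟨⟨A, G⟩, h1, h2, h3⟩
    obtain ⟨A', G', a, b, c, d, e, f⟩ :=
      hm.exists_between h1 h2 h3 (η := 1 / ((n : ℝ) + 1)) (by positivity)
    exact ⟨⟨⟨A', G'⟩, b, d, e⟩, a, c, f⟩
  choose next hnext1 hnext2 hnext3 using step
  let init : S := ⟨⟨⟨∅, MeasurableSet.empty⟩, E⟩, empty_subset _, m.prob_empty.le.trans hs0, hsE⟩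
  let p : ℕ → S := fun n => Nat.rec init (fun n q => next n q) n
  have hmono : Monotone fun n => (p n).1.1.1 := monotone_nat_of_le_succ fun n => hnext1 n (p n)
  have hanti : Antitone fun n => (p n).1.2.1 := antitone_nat_of_succ_le fun n => hnext2 n (p n)
  let F : Event Ω := ⟨⋃ n, (p n).1.1.1, MeasurableSet.iUnion fun n => (p n).1.1.2⟩
  have hF1 : ∀ n, m.prob (p n).1.1 ≤ m.prob F := fun n =>
    m.mono (subset_iUnion (fun n => (p n).1.1.1) n)
  have hFG : ∀ n, F.1 ⊆ (p n).1.2.1 := fun n => iUnion_subset fun k =>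
    (hmono (le_max_left k n)).trans ((p (max k n)).2.1.trans (hanti (le_max_right k n)))
  have hF2 : ∀ n, m.prob F ≤ m.prob (p n).1.2 := fun n => m.mono (hFG n)
  refine ⟨F, hFG 0, le_antisymm ?_ ?_⟩
  all_goals
    refine le_of_forall_pos_le_add fun η hη => ?_
    obtain ⟨n, hn⟩ := exists_nat_one_div_lt hη
    have h3 := hnext3 n (p n)
    have h4 := (p (n + 1)).2.2
    have h5 := hF1 (n + 1)
    have h6 := hF2 (n + 1)
    change m.prob (p (n + 1)).1.2 ≤ m.prob (p (n + 1)).1.1 + _ at h3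
    linarith [h4.1, h4.2]

/-- The conditional of a finitely additive probability on an event of positive probability. -/
def FinAddProb.condOn (m : FinAddProb Ω) (C : Event Ω) (hC : m.prob C ≠ 0) : FinAddProb Ω where
  prob E := m.prob ⟨E.1 ∩ C.1, E.2.inter C.2⟩ / m.prob C
  nonneg E := div_nonneg (m.nonneg _) (m.nonneg _)
  prob_univ := by
    simp only [univ_inter]
    exact div_self hC
  prob_union E F h := by
    rw [← add_div, ← m.prob_union ⟨E.1 ∩ C.1, E.2.inter C.2⟩ ⟨F.1 ∩ C.1, F.2.inter C.2⟩
      (h.mono inter_subset_left inter_subset_left)]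
    simp only [union_inter_distrib_right]

/-- The point mass at `x`. -/
def FinAddProb.dirac (x : Ω) : FinAddProb Ω where
  prob E := E.1.indicator 1 x
  nonneg E := indicator_nonneg (fun _ _ => zero_le_one) x
  prob_univ := by simp
  prob_union E F h := by rw [indicator_union_of_disjoint h]

end FinitelyAdditive

/-! ### Extension of an opinion to a conditional opinion. -/

section Extension

variable {X : Type*}

open Classical in
/-- The path in a cylinder that is constantly `a` after the common initial segment. -/
def basePath (a : X) (C : Cyl X) : Path X := fun k =>
  if ∃ v, ∀ η ∈ C.1, η k = v then Classical.choose C.2 k else a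

/-- With two points in `X`, the coordinates fixed by the set `ω^t` are exactly those below `t`, so
the base path does not depend on how the cylinder is represented. -/
theorem basePath_cyl [Nontrivial X] (a : X) (ω : Path X) (t k : ℕ) :
    basePath a (cyl ω t) k = if k < t then ω k else a := by
  unfold basePath
  split_ifs with h1 h2 h2
  · obtain ⟨s, hs⟩ := Classical.choose_spec (cyl ω t).2
    have hmem : Classical.choose (cyl ω t).2 ∈ PiNat.cylinder ω t := by
      have h := PiNat.self_mem_cylinder (Classical.choose (cyl ω t).2) s
      rw [hs] at h
      exact h
    exact hmem k h2
  · obtain ⟨v, hv⟩ := h1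
    obtain ⟨u, hu⟩ := exists_ne v
    refine absurd (hv (Function.update ω k u) fun i hi => ?_) (by simpa using hu)
    exact Function.update_of_ne (by omega) _ _
  · exact absurd ⟨ω k, fun η hη => hη k h2⟩ h1
  · rfl

theorem basePath_mem [Nontrivial X] (a : X) (ω : Path X) (t : ℕ) :
    basePath a (cyl ω t) ∈ PiNat.cylinder ω t := fun i hi => by
  rw [basePath_cyl, if_pos hi]

/-- This compatibility of the point masses is the chain rule inside a null cylinder. -/
theorem basePath_eq_of_mem [Nontrivial X] {a : X} {ω : Path X} {t n : ℕ}
    (h : basePath a (cyl ω t) ∈ PiNat.cylinder ω (t + n)) :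
    basePath a (cyl ω (t + n)) = basePath a (cyl ω t) := by
  ext k
  have hk := h k
  rw [basePath_cyl] at hk ⊢
  rw [basePath_cyl]
  split_ifs at hk ⊢ <;> grind

variable [MetricSpace X] [MeasurableSpace (Path X)] [OpensMeasurableSpace (Path X)]

/-- Cylinders are events. -/
def Cyl.toEvent (C : Cyl X) : Event (Path X) :=
  ⟨C.1, by obtain ⟨ω, t, h⟩ := C.2; exact h ▸ measurableSet_cylinder ω t⟩

open Classical in
/-- Bayesian updating, with a point mass on the base path of each null cylinder. -/
def condOfFinAddProb (a : X) (m : FinAddProb (Path X)) (C : Cyl X) : FinAddProb (Path X) :=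
  if h : m.prob C.toEvent = 0 then .dirac (basePath a C) else m.condOn C.toEvent h

/-- Every finitely additive probability extends to a conditional probability. -/
def FinAddProb.toCondProb [Nontrivial X] (a : X) (m : FinAddProb (Path X)) : CondProb X where
  cond := condOfFinAddProb a m
  cond_self ω t := by
    unfold condOfFinAddProb
    split_ifs with h
    · simp only [dirac, cylEvent]
      rw [indicator_of_mem (basePath_mem a ω t)]
      rfl
    · simp only [condOn, cylEvent, Cyl.toEvent, cyl, inter_self]
      exact div_self h
  cond_chain ω t n E := by
    have hsub : PiNat.cylinder ω (t + n) ⊆ PiNat.cylinder ω t :=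
      PiNat.cylinder_anti ω (Nat.le_add_right t n)
    have hle : m.prob (cyl ω (t + n)).toEvent ≤ m.prob (cyl ω t).toEvent := m.mono hsub
    have h0 := m.nonneg (cyl ω (t + n)).toEvent
    unfold condOfFinAddProb
    by_cases h : m.prob (cyl ω t).toEvent = 0
    · have h' : m.prob (cyl ω (t + n)).toEvent = 0 := le_antisymm (h ▸ hle) h0
      rw [dif_pos h, dif_pos h']
      simp only [dirac, cylEvent]
      by_cases hb : basePath a (cyl ω t) ∈ PiNat.cylinder ω (t + n)
      · rw [basePath_eq_of_mem hb, indicator_of_mem hb, inter_indicator_one]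
        simp [indicator_of_mem hb]
      · rw [indicator_of_notMem hb, indicator_of_notMem fun hx => hb hx.2, mul_zero]
    · rw [dif_neg h]
      have e1 : (⟨(E.1 ∩ PiNat.cylinder ω (t + n)) ∩ PiNat.cylinder ω t,
          (E.2.inter (measurableSet_cylinder ω (t + n))).inter (measurableSet_cylinder ω t)⟩ :
            Event (Path X)) =
          ⟨E.1 ∩ PiNat.cylinder ω (t + n), E.2.inter (measurableSet_cylinder ω (t + n))⟩ :=
        Subtype.ext (inter_eq_left.2 (inter_subset_right.trans hsub))
      have e2 : (⟨PiNat.cylinder ω (t + n) ∩ PiNat.cylinder ω t,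
          (measurableSet_cylinder ω (t + n)).inter (measurableSet_cylinder ω t)⟩ :
            Event (Path X)) = (cyl ω (t + n)).toEvent :=
        Subtype.ext (inter_eq_left.2 hsub)
      change m.prob ⟨(E.1 ∩ PiNat.cylinder ω (t + n)) ∩ PiNat.cylinder ω t, _⟩ / _ =
        _ * (m.prob ⟨PiNat.cylinder ω (t + n) ∩ PiNat.cylinder ω t, _⟩ / _)
      rw [e1, e2]
      by_cases h' : m.prob (cyl ω (t + n)).toEvent = 0
      · have h2 : m.prob ⟨E.1 ∩ PiNat.cylinder ω (t + n),
            E.2.inter (measurableSet_cylinder ω (t + n))⟩ = 0 :=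
          le_antisymm (h' ▸ m.mono inter_subset_right) (m.nonneg _)
        have h3 : m.prob (cyl ω (t + n)).toEvent / m.prob (cyl ω t).toEvent = 0 := by
          rw [h', zero_div]
        rw [h2, h3, zero_div, mul_zero]
      · rw [dif_neg h']
        change _ = m.prob ⟨E.1 ∩ PiNat.cylinder ω (t + n), _⟩ /
          m.prob (cyl ω (t + n)).toEvent * _
        field_simp

theorem FinAddProb.toCondProb_cond_wholeCyl [Nontrivial X] (a : X) (m : FinAddProb (Path X)) :
    (m.toCondProb a).cond (wholeCyl X) = m := by
  have h1 : m.prob (wholeCyl X).toEvent = 1 := m.prob_univ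
  change condOfFinAddProb a m (wholeCyl X) = m
  unfold condOfFinAddProb
  rw [dif_neg (by rw [h1]; exact one_ne_zero)]
  ext E
  simp only [condOn, h1, div_one]
  congr 1
  exact Subtype.ext (inter_univ _)

/-- Every strongly nonatomic finitely additive probability extends to a conditional opinion. -/
theorem FinAddProb.StronglyNonatomic.exists_condOpinion [Nontrivial X]
    {m : FinAddProb (Path X)} (hm : m.StronglyNonatomic) : ∃ P : CondOpinion X, P.uncond = m := by
  let a := Classical.arbitrary X
  exact ⟨⟨m.toCondProb a, (m.toCondProb_cond_wholeCyl a).symm ▸ hm⟩, m.toCondProb_cond_wholeCyl a⟩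

end Extension

/-! ### Separation in `ℓ^∞`. -/

section Separation

variable {S : Type*}

/-- A function bounded by `1` as a member of `ℓ^∞`. -/
def toBdd (f : S → ℝ) (hf : ∀ s, |f s| ≤ 1) : lp (fun _ : S => ℝ) ∞ :=
  ⟨f, memℓp_infty ⟨1, by rintro _ ⟨s, rfl⟩; exact hf s⟩⟩

@[simp]
theorem toBdd_apply (f : S → ℝ) (hf : ∀ s, |f s| ≤ 1) (s : S) : toBdd f hf s = f s := rfl

/-- A convex set of bounded functions each of which takes a value above `c` admits a mean
that is at least `c` on it. -/
theorem exists_mean_of_convex [Nonempty S] {K : Set (lp (fun _ : S => ℝ) ∞)} (hK : Convex ℝ K)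
    {c : ℝ} (hc : ∀ f ∈ K, ∃ s, c ≤ f s) :
    ∃ l : lp (fun _ : S => ℝ) ∞ →ₗ[ℝ] ℝ, (∀ f, (∀ s, 0 ≤ f s) → 0 ≤ l f) ∧
      l (toBdd 1 (by simp)) = 1 ∧ ∀ f ∈ K, c ≤ l f := by
  set e : lp (fun _ : S => ℝ) ∞ := toBdd 1 (by simp) with he
  have hes : ∀ s, e s = 1 := fun s => rfl
  rcases K.eq_empty_or_nonempty with rfl | ⟨k, hk⟩
  · let s := Classical.arbitrary S
    exact ⟨{ toFun := fun f => f s, map_add' := fun _ _ => rfl, map_smul' := fun _ _ => rfl },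
      fun f hf => hf s, rfl, by simp⟩
  -- The uniform gap below `c` makes this set open in the sup norm.
  let A : Set (lp (fun _ : S => ℝ) ∞) := {f | ∃ r < c, ∀ s, f s ≤ r}
  have hAc : Convex ℝ A := by
    rintro f ⟨r, hr, hf⟩ g ⟨q, hq, hg⟩ x y hx hy hxy
    refine ⟨x * r + y * q, ?_, fun s => ?_⟩
    · have hr' : r ≤ max r q := le_max_left _ _
      have hq' : q ≤ max r q := le_max_right _ _
      have hm : max r q < c := max_lt hr hq
      calc x * r + y * q ≤ x * max r q + y * max r q := by gcongr
        _ = max r q := by rw [← add_mul, hxy, one_mul]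
        _ < c := hm
    · change x * f s + y * g s ≤ _
      gcongr
      · exact hf s
      · exact hg s
  have hAo : IsOpen A := by
    rw [Metric.isOpen_iff]
    rintro f ⟨r, hr, hf⟩
    refine ⟨(c - r) / 2, by linarith, fun g hg => ⟨(c + r) / 2, by linarith, fun s => ?_⟩⟩
    have h1 : ‖(g - f) s‖ ≤ ‖g - f‖ := lp.norm_apply_le_norm (by simp) _ _
    rw [mem_ball_iff_norm] at hg
    have h2 : g s - f s ≤ ‖(g - f) s‖ := le_abs_self (g s - f s)
    linarith [hf s]
  have hd : Disjoint A K := by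
    rw [Set.disjoint_left]
    rintro f ⟨r, hr, hf⟩ hfK
    obtain ⟨s, hs⟩ := hc f hfK
    linarith [hf s]
  obtain ⟨l, u, hlA, hlK⟩ := geometric_hahn_banach_open hAc hAo hK hd
  have hpos : ∀ f : lp (fun _ : S => ℝ) ∞, (∀ s, 0 ≤ f s) → 0 ≤ l f := by
    intro f hf
    by_contra! hneg
    have h1 : ∀ x : ℝ, 0 ≤ x → (c - 1) * l e - x * l f < u := by
      intro x hx
      have := hlA ((c - 1) • e - x • f) ⟨c - 1, by linarith, fun s => ?_⟩
      · simpa using this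
      · change (c - 1) * 1 - x * f s ≤ c - 1
        linarith [mul_nonneg hx (hf s)]
    have h2 := h1 (|u - (c - 1) * l e| / (-l f)) (by have := neg_pos.2 hneg; positivity)
    rw [div_mul_eq_mul_div, mul_div_assoc, div_neg, div_self hneg.ne] at h2
    linarith [le_abs_self (u - (c - 1) * l e)]
  have hbd : ∀ r < c, r * l e < u := by
    intro r hr
    have := hlA (r • e) ⟨r, hr, fun s => by change r * 1 ≤ r; linarith⟩
    simpa using this
  -- If `l e = 0`, then `‖k‖ e - k ≥ 0` forces `l k ≤ 0`, whereas `0 < u ≤ l k`.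
  have hle : 0 < l e := by
    refine lt_of_le_of_ne (hpos e fun s => by rw [hes]; exact zero_le_one) fun h0 => ?_
    have h1 := hpos (‖k‖ • e - k) fun s => by
      change 0 ≤ ‖k‖ * 1 - k s
      have h1 : ‖k s‖ ≤ ‖k‖ := lp.norm_apply_le_norm (by simp) _ _
      linarith [le_abs_self (k s), Real.norm_eq_abs (k s)]
    have h2 := hbd (c - 1) (by linarith)
    have h3 := hlK k hk
    rw [map_sub, map_smul, ← h0] at h1
    rw [← h0] at h2
    simp only [smul_zero, mul_zero, zero_sub] at h1 h2
    linarith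
  have hcu : c * l e ≤ u := by
    refine le_of_forall_pos_le_add fun η hη => ?_
    have h1 := hbd (c - η / l e) (by have := div_pos hη hle; linarith)
    rw [sub_mul, div_mul_cancel₀ _ hle.ne'] at h1
    linarith
  refine ⟨(l e)⁻¹ • (l : lp (fun _ : S => ℝ) ∞ →ₗ[ℝ] ℝ), fun f hf => ?_, ?_, fun f hf => ?_⟩
  · exact mul_nonneg (inv_nonneg.2 hle.le) (hpos f hf)
  · exact inv_mul_cancel₀ hle.ne'
  · change c ≤ (l e)⁻¹ * l f
    rw [inv_mul_eq_div, le_div_iff₀ hle]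
    exact hcu.trans (hlK f hf)

end Separation

/-! ### Diffuse probabilities infinitesimally close to a path, and their mixtures. -/

section Diffuse

variable {X : Type*}

/-- The path that follows `ω` in the first `n` periods and `y` afterwards. -/
def splice (ω y : Path X) (n : ℕ) : Path X := fun k => if k < n then ω k else y k

theorem eventually_splice_mem [TopologicalSpace X] {U : Set (Path X)} (hU : IsOpen U)
    {ω : Path X} (hω : ω ∈ U) : ∀ᶠ n in atTop, ∀ y, splice ω y n ∈ U := by
  obtain ⟨I, u, hu, hsub⟩ := isOpen_pi_iff.1 hU ω hω
  filter_upwards [eventually_gt_atTop (I.sup id)] with n hn y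
  refine hsub fun i hi => ?_
  have : i < n := (Finset.le_sup (f := id) hi).trans_lt hn
  simpa [splice, this] using (hu i hi).2

/-- The paths that eventually agree with `y`. -/
def tailClass (y : Path X) : Set (Path X) := {η | ∃ n, ∀ k, n ≤ k → η k = y k}

theorem splice_mem_tailClass (ω y : Path X) (n : ℕ) : splice ω y n ∈ tailClass y :=
  ⟨n, fun k hk => by simp [splice, not_lt.2 hk]⟩

theorem measurableSet_tailClass [MetricSpace X] [MeasurableSpace (Path X)]
    [OpensMeasurableSpace (Path X)] (y : Path X) : MeasurableSet (tailClass y) := by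
  have h : tailClass y = ⋃ n, ⋂ k, ⋂ (_ : n ≤ k), {η : Path X | η k = y k} := by
    ext; simp [tailClass]
  rw [h]
  refine MeasurableSet.iUnion fun n => IsClosed.measurableSet ?_
  exact isClosed_iInter fun k => isClosed_iInter fun _ =>
    isClosed_eq (continuous_apply k) continuous_const

theorem exists_disjoint_tailClass (X : Type*) [Nontrivial X] :
    ∃ y : ℕ → Path X, Pairwise fun i j => Disjoint (tailClass (y i)) (tailClass (y j)) := by
  obtain ⟨a, b, hab⟩ := exists_pair_ne X
  refine ⟨fun j k => if k.unpair.1 = j then a else b, fun i j hij => ?_⟩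
  refine Set.disjoint_left.2 ?_
  rintro η ⟨n, hn⟩ ⟨m, hm⟩
  -- A coordinate beyond both `n` and `m` at which `y i` is `a` and `y j` is `b`.
  have h1 := hn (Nat.pair i (max n m)) ((le_max_left _ _).trans (Nat.right_le_pair _ _))
  have h2 := hm (Nat.pair i (max n m)) ((le_max_right _ _).trans (Nat.right_le_pair _ _))
  rw [h1] at h2
  simp [hij, hab] at h2

/-- The uniform distribution on the first `n + 1` splices of `ω` with the paths `y j`. -/
def spliceAvg (y : ℕ → Path X) (ω : Path X) (E : Set (Path X)) (n : ℕ) : ℝ :=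
  (∑ j ∈ Finset.range (n + 1), E.indicator 1 (splice ω (y j) n)) / (n + 1)

theorem spliceAvg_nonneg (y : ℕ → Path X) (ω : Path X) (E : Set (Path X)) (n : ℕ) :
    0 ≤ spliceAvg y ω E n :=
  div_nonneg (Finset.sum_nonneg fun _ _ => indicator_nonneg (fun _ _ => zero_le_one) _)
    (by positivity)

theorem spliceAvg_eq_one {y : ℕ → Path X} {ω : Path X} {E : Set (Path X)} {n : ℕ}
    (h : ∀ z, splice ω z n ∈ E) : spliceAvg y ω E n = 1 := by
  unfold spliceAvg
  rw [Finset.sum_congr rfl fun j _ => indicator_of_mem (h (y j)) _]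
  simp only [Pi.one_apply, Finset.sum_const, Finset.card_range, nsmul_eq_mul, mul_one]
  push_cast
  exact div_self (by positivity)

theorem spliceAvg_le_one (y : ℕ → Path X) (ω : Path X) (E : Set (Path X)) (n : ℕ) :
    spliceAvg y ω E n ≤ 1 := by
  rw [← spliceAvg_eq_one (y := y) (ω := ω) (n := n) fun z => mem_univ (splice ω z n)]
  have h : ∀ z, E.indicator (1 : Path X → ℝ) z ≤ univ.indicator 1 z := fun z =>
    indicator_le_indicator_of_subset (subset_univ E) (fun _ => zero_le_one) z
  exact div_le_div_of_nonneg_right (Finset.sum_le_sum fun _ _ => h _) (by positivity)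

theorem spliceAvg_union (y : ℕ → Path X) (ω : Path X) {E F : Set (Path X)} (h : Disjoint E F)
    (n : ℕ) : spliceAvg y ω (E ∪ F) n = spliceAvg y ω E n + spliceAvg y ω F n := by
  simp only [spliceAvg, indicator_union_of_disjoint h, Finset.sum_add_distrib, add_div]

theorem card_filter_mod_eq_le (N i n : ℕ) :
    ((Finset.range n).filter fun j => j % N = i).card ≤ n / N + 1 := by
  have h : ((Finset.range n).filter fun j => j % N = i).card ≤ (Finset.range (n / N + 1)).card := by
    refine Finset.card_le_card_of_injOn (fun j => j / N) (fun j hj => ?_) fun j hj k hk hjk => ?_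
    · simp only [Finset.coe_filter, Finset.mem_range, mem_ofPred_eq, Finset.coe_range, mem_Iio]
        at hj ⊢
      exact Nat.lt_succ_of_le (Nat.div_le_div_right hj.1.le)
    · simp only [Finset.coe_filter, Finset.mem_range, mem_ofPred_eq] at hj hk
      rw [← Nat.div_add_mod j N, ← Nat.div_add_mod k N, hj.2, hk.2]
      simp only at hjk
      rw [hjk]
  simpa using h

/-- The paths outside the tail classes of all `y j` with `j` not congruent to `i` modulo `N`. -/
def residueSet (y : ℕ → Path X) (N i : ℕ) : Set (Path X) :=
  ⋂ (j : ℕ) (_ : j % N ≠ i), (tailClass (y j))ᶜ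

theorem measurableSet_residueSet [MetricSpace X] [MeasurableSpace (Path X)]
    [OpensMeasurableSpace (Path X)] (y : ℕ → Path X) (N i : ℕ) :
    MeasurableSet (residueSet y N i) :=
  MeasurableSet.iInter fun j => MeasurableSet.iInter fun _ => (measurableSet_tailClass (y j)).compl

theorem iUnion_residueSet {y : ℕ → Path X}
    (hy : Pairwise fun i j => Disjoint (tailClass (y i)) (tailClass (y j))) {N : ℕ} (hN : 0 < N) :
    ⋃ i ∈ Finset.range N, residueSet y N i = univ := by
  refine eq_univ_of_forall fun η => ?_
  simp only [mem_iUnion, Finset.mem_range, residueSet, mem_iInter, mem_compl_iff, exists_prop]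
  by_cases h : ∃ j, η ∈ tailClass (y j)
  · obtain ⟨j, hj⟩ := h
    refine ⟨j % N, Nat.mod_lt _ hN, fun k hk hηk => ?_⟩
    exact Set.disjoint_left.1 (hy fun hjk : j = k => hk (hjk ▸ rfl)) hj hηk
  · exact ⟨0, hN, fun j _ hj => h ⟨j, hj⟩⟩

/-- Only splices with `j ≡ i` modulo `N` can lie in the set. There are at most `(n + 1) / N + 1` of
them, and `N ≤ n + 1` absorbs the extra one into the factor `2`. -/
theorem spliceAvg_residueSet_le (y : ℕ → Path X) (ω : Path X) {N n : ℕ} (hN : 0 < N) (hn : N ≤ n)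
    (i : ℕ) : spliceAvg y ω (residueSet y N i) n ≤ 2 / N := by
  have h1 : ∑ j ∈ Finset.range (n + 1), (residueSet y N i).indicator (1 : Path X → ℝ)
      (splice ω (y j) n) ≤ ∑ j ∈ Finset.range (n + 1), if j % N = i then (1 : ℝ) else 0 := by
    refine Finset.sum_le_sum fun j _ => ?_
    split_ifs with h
    · exact indicator_apply_le' (fun _ => le_rfl) fun _ => zero_le_one
    · refine (indicator_of_notMem (fun hm => ?_) _).le
      simp only [residueSet, mem_iInter] at hm
      exact hm j h (splice_mem_tailClass ω (y j) n)
  rw [Finset.sum_boole] at h1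
  have h2 : (((Finset.range (n + 1)).filter fun j => j % N = i).card : ℝ) ≤ (n + 1 : ℝ) / N + 1 := by
    refine (Nat.cast_le.2 (card_filter_mod_eq_le N i (n + 1))).trans ?_
    push_cast
    gcongr
    exact_mod_cast Nat.cast_div_le (α := ℝ) (m := n + 1) (n := N)
  have hN' : (0 : ℝ) < N := by exact_mod_cast hN
  have hn' : (N : ℝ) ≤ n + 1 := by exact_mod_cast hn.trans (Nat.le_succ n)
  unfold spliceAvg
  rw [div_le_div_iff₀ (by positivity) hN']
  have h3 := mul_le_mul_of_nonneg_right (h1.trans h2) hN'.le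
  rw [add_mul, div_mul_cancel₀ _ hN'.ne'] at h3
  linarith

theorem exists_tendsto_spliceAvg (y : ℕ → Path X) (ω : Path X) (E : Set (Path X)) :
    ∃ l : ℝ, Tendsto (spliceAvg y ω E) (hyperfilter ℕ) (𝓝 l) := by
  obtain ⟨l, -, hl⟩ := (isCompact_Icc (a := (0 : ℝ)) (b := 1)).ultrafilter_le_nhds
    ((hyperfilter ℕ).map (spliceAvg y ω E)) (by
      rw [le_principal_iff]
      refine mem_map.2 (univ_mem' fun n => ?_)
      exact ⟨spliceAvg_nonneg y ω E n, spliceAvg_le_one y ω E n⟩)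
  exact ⟨l, hl⟩

/-- The limit of the uniform distributions on the splices of `ω`: a diffuse finitely additive
probability that is concentrated infinitesimally close to `ω`. -/
def diffuse (y : ℕ → Path X) (ω : Path X) (E : Set (Path X)) : ℝ :=
  Classical.choose (exists_tendsto_spliceAvg y ω E)

theorem tendsto_diffuse (y : ℕ → Path X) (ω : Path X) (E : Set (Path X)) :
    Tendsto (spliceAvg y ω E) (hyperfilter ℕ) (𝓝 (diffuse y ω E)) :=
  Classical.choose_spec (exists_tendsto_spliceAvg y ω E)

theorem diffuse_nonneg (y : ℕ → Path X) (ω : Path X) (E : Set (Path X)) : 0 ≤ diffuse y ω E :=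
  ge_of_tendsto' (tendsto_diffuse y ω E) (spliceAvg_nonneg y ω E)

theorem diffuse_le_one (y : ℕ → Path X) (ω : Path X) (E : Set (Path X)) : diffuse y ω E ≤ 1 :=
  le_of_tendsto' (tendsto_diffuse y ω E) (spliceAvg_le_one y ω E)

theorem abs_diffuse_le_one (y : ℕ → Path X) (ω : Path X) (E : Set (Path X)) :
    |diffuse y ω E| ≤ 1 :=
  abs_le.2 ⟨by linarith [diffuse_nonneg y ω E], diffuse_le_one y ω E⟩

theorem diffuse_union (y : ℕ → Path X) (ω : Path X) {E F : Set (Path X)} (h : Disjoint E F) :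
    diffuse y ω (E ∪ F) = diffuse y ω E + diffuse y ω F :=
  tendsto_nhds_unique (tendsto_diffuse y ω _)
    (((tendsto_diffuse y ω E).add (tendsto_diffuse y ω F)).congr fun n =>
      (spliceAvg_union y ω h n).symm)

theorem diffuse_eq_one_of_isOpen [TopologicalSpace X] (y : ℕ → Path X) {ω : Path X}
    {U : Set (Path X)} (hU : IsOpen U) (hω : ω ∈ U) : diffuse y ω U = 1 :=
  tendsto_nhds_unique (tendsto_diffuse y ω U) <| tendsto_const_nhds.congr' <|
    ((eventually_splice_mem hU hω).filter_mono Nat.hyperfilter_le_atTop).mono fun _ hn =>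
      (spliceAvg_eq_one hn).symm

theorem diffuse_univ (y : ℕ → Path X) (ω : Path X) : diffuse y ω univ = 1 :=
  tendsto_nhds_unique (tendsto_diffuse y ω univ) <| tendsto_const_nhds.congr fun _ =>
    (spliceAvg_eq_one fun _ => mem_univ _).symm

theorem diffuse_residueSet_le (y : ℕ → Path X) (ω : Path X) {N : ℕ} (hN : 0 < N) (i : ℕ) :
    diffuse y ω (residueSet y N i) ≤ 2 / N :=
  le_of_tendsto (tendsto_diffuse y ω _) <|
    ((eventually_ge_atTop N).filter_mono Nat.hyperfilter_le_atTop).mono fun _ hn =>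
      spliceAvg_residueSet_le y ω hN hn i

/-- The bounded function `ω ↦ diffuse y ω E`. -/
def diffuseBdd (y : ℕ → Path X) (E : Set (Path X)) : lp (fun _ : Path X => ℝ) ∞ :=
  toBdd (fun ω => diffuse y ω E) fun ω => abs_diffuse_le_one y ω E

variable [MeasurableSpace (Path X)]

/-- The mixture of the diffuse probabilities `diffuse y ω` with respect to a mean. -/
def mixture (y : ℕ → Path X) (l : lp (fun _ : Path X => ℝ) ∞ →ₗ[ℝ] ℝ)
    (hl : ∀ f, (∀ s, 0 ≤ f s) → 0 ≤ l f) (hl1 : l (toBdd 1 (by simp)) = 1) :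
    FinAddProb (Path X) where
  prob E := l (diffuseBdd y E.1)
  nonneg E := hl _ fun ω => diffuse_nonneg y ω E.1
  prob_univ := by
    rw [← hl1]
    congr 1
    ext ω
    exact diffuse_univ y ω
  prob_union E F h := by
    rw [← map_add]
    congr 1
    ext ω
    exact diffuse_union y ω h

/-- The residue sets do not depend on `ω`, and neither does their bound `2 / N`, so the bound
survives averaging. -/
theorem mixture_stronglyContinuous [MetricSpace X] [OpensMeasurableSpace (Path X)]
    {y : ℕ → Path X} (hy : Pairwise fun i j => Disjoint (tailClass (y i)) (tailClass (y j)))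
    (l : lp (fun _ : Path X => ℝ) ∞ →ₗ[ℝ] ℝ)
    (hl : ∀ f, (∀ s, 0 ≤ f s) → 0 ≤ l f) (hl1 : l (toBdd 1 (by simp)) = 1) :
    (mixture y l hl hl1).StronglyContinuous := by
  intro η hη
  obtain ⟨N, hN⟩ := exists_nat_gt (2 / η)
  have hN0 : (0 : ℝ) < N := (by positivity : (0 : ℝ) < 2 / η).trans hN
  have hN' : 0 < N := by exact_mod_cast hN0
  have hNη : 2 / (N : ℝ) ≤ η := by
    rw [div_lt_iff₀ hη] at hN
    rw [div_le_iff₀ hN0]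
    linarith
  refine ⟨N, fun i => ⟨residueSet y N i, measurableSet_residueSet y N i⟩, fun i => ?_,
    iUnion_residueSet hy hN'⟩
  have h := hl (η • toBdd 1 (by simp) - diffuseBdd y (residueSet y N i)) fun ω => by
    change 0 ≤ η * 1 - diffuse y ω (residueSet y N i)
    linarith [diffuse_residueSet_le y ω hN' i]
  rw [map_sub, map_smul, hl1, smul_eq_mul, mul_one] at h
  exact sub_nonneg.1 h

end Diffuse

/-! ### The minimax argument. -/

section Game

variable {X : Type*} [MetricSpace X] [MeasurableSpace (Path X)] [OpensMeasurableSpace (Path X)]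

theorem Strategy.sum_indicator_eq [Nonempty X] (ζ : Strategy X) (T : Test X) (ω : Path X) :
    ∑ P ∈ ζ.weight.support, ζ.weight P * (T P : Set (Path X)).indicator 1 ω =
      1 - ζ.prob {P | ω ∉ T P} := by
  classical
  rw [← ζ.weight_total, Strategy.prob, eq_sub_iff_add_eq, Finset.sum_filter,
    ← Finset.sum_add_distrib]
  refine Finset.sum_congr rfl fun P _ => ?_
  by_cases h : ω ∈ T P <;> simp [h]

/-- The minimax step: if `T` cannot be manipulated, then some strongly nonatomic opinion gives
probability at least `c` to every rejection set. -/
theorem Test.exists_opinion_of_not_canBeManipulated [Nontrivial X] (T : Test X) {c : ℝ}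
    (h : ¬ T.CanBeManipulated (1 - c)) :
    ∃ Q : CondOpinion X, ∀ P, c ≤ Q.uncond.prob (openEvent (T P)) := by
  obtain ⟨y, hy⟩ := exists_disjoint_tailClass X
  let F : CondOpinion X → lp (fun _ : Path X => ℝ) ∞ := fun P => diffuseBdd y (T P)
  let W : Set (CondOpinion X →₀ ℝ) :=
    {w | (∀ P, 0 ≤ w P) ∧ Finsupp.linearCombination ℝ (fun _ : CondOpinion X => (1 : ℝ)) w = 1}
  have hW : Convex ℝ W := by
    rintro v ⟨hv, hv1⟩ w ⟨hw, hw1⟩ a b ha hb hab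
    refine ⟨fun P => ?_, ?_⟩
    · exact add_nonneg (mul_nonneg ha (hv P)) (mul_nonneg hb (hw P))
    · rw [map_add, map_smul, map_smul, hv1, hw1, smul_eq_mul, smul_eq_mul, mul_one, mul_one, hab]
  obtain ⟨l, hl, hl1, hlK⟩ := exists_mean_of_convex
    (hW.linear_image (Finsupp.linearCombination ℝ F)) (c := c) (by
      rintro _ ⟨w, ⟨hw, hw1⟩, rfl⟩
      let ζ : Strategy X := ⟨w, hw, by
        simpa [Finsupp.linearCombination_apply, Finsupp.sum] using hw1⟩
      -- If the mixture stayed below `c` everywhere, so would the smaller rejection probability of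
      -- `ζ`, and `ζ` would manipulate `T`.
      by_contra! hlt
      refine h ⟨ζ, fun ω => ?_⟩
      have h1 := ζ.sum_indicator_eq T ω
      have h2 : Finsupp.linearCombination ℝ F w ω = ∑ P ∈ w.support, w P * diffuse y ω (T P) := by
        rw [Finsupp.linearCombination_apply, Finsupp.sum, lp.coeFn_sum, Finset.sum_apply]
        rfl
      have h3 : ∑ P ∈ w.support, w P * (T P : Set (Path X)).indicator 1 ω ≤
          ∑ P ∈ w.support, w P * diffuse y ω (T P) := by
        refine Finset.sum_le_sum fun P _ => mul_le_mul_of_nonneg_left ?_ (hw P)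
        exact indicator_apply_le' (fun hω => (diffuse_eq_one_of_isOpen y (T P).isOpen hω).ge)
          fun _ => diffuse_nonneg y ω _
      have h4 := hlt ω
      rw [h2] at h4
      change ∑ P ∈ w.support, w P * (T P : Set (Path X)).indicator 1 ω = _ at h1
      linarith)
  obtain ⟨Q, hQ⟩ :=
    (mixture_stronglyContinuous hy l hl hl1).stronglyNonatomic.exists_condOpinion
  refine ⟨Q, fun P => ?_⟩
  rw [hQ]
  refine hlK _ ⟨Finsupp.single P 1, ⟨fun P' => ?_, by simp⟩, ?_⟩
  · exact (Finsupp.single_nonneg.2 zero_le_one) P'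
  · rw [Finsupp.linearCombination_single, one_smul]
    rfl

end Game

end OpinionTest

end

/-- `Σ` is the given `MeasurableSpace` structure on the paths; `OpensMeasurableSpace` says that it
contains all open sets. -/
theorem theorem5 {X : Type*} [MetricSpace X] [TopologicalSpace.SeparableSpace X] [Nontrivial X]
    [MeasurableSpace (OpinionTest.Path X)] [OpensMeasurableSpace (OpinionTest.Path X)]
    (ε : ℝ) (hε0 : 0 ≤ ε) (hε1 : ε < 1)
    (T : OpinionTest.Test X) (hT : T.ControlsTypeI Set.univ ε)
    (δ : ℝ) (hδ0 : 0 < δ) (hδ1 : δ ≤ 1 - ε) :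
    T.CanBeManipulated (1 - ε - δ) := by
  by_contra h
  obtain ⟨Q, hQ⟩ := T.exists_opinion_of_not_canBeManipulated (c := ε + δ) (by rwa [← sub_sub])
  -- The opinion `Q` is tested against its own rejection set.
  linarith [hQ Q, hT Q (Set.mem_univ Q)]
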